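/- Model. Let $V$ be a set of $n \ge 1$ vertices and $\ell$ a positive integer dividing $n$. An \emph{assignment} maps each vertex to one of $\ell$ servers; the \emph{load} of a server is the number of vertices assigned to it. An unknown communication graph $G=(V,E)$ has exactly $\ell$ connected components $V_0,\dots,V_{\ell-1}$, each with $n/\ell$ vertices. An adversary presents edges $e_1,\dots,e_r$ of $G$ one at a time (repetitions allowed), such that the graph formed by all presented edges has the same connected components as $G$. The initial assignment is given, and every server has load exactly $n/\ell$ in it. A vertex may be moved to another server at any time, at cost $\alpha>1$; a request $e_t$ costs $1$ if its endpoints are on different servers when it arrives, and $0$ otherwise. Each server has capacity $(1+\varepsilon)n/\ell$: its load must never exceed this value. After the last request has been served, the vertex sets on the servers must be exactly $V_0,\dots,V_{\ell-1}$ (in any order). A deterministic online algorithm chooses the current assignment knowing only $V$, $\ell$, $\varepsilon$, $\alpha$, the initial assignment and the requests presented so far. Let $\mathrm{ALG}$ be its total (moving plus communication) cost, and let $\mathrm{OFF}$ be the minimum total cost of a schedule that satisfies the same constraints but may be chosen knowing $G$ and the whole request sequence in advance (and may move vertices before the first request). The algorithm is $\rho$-competitive if it satisfies the constraints and $\mathrm{ALG}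 \le \rho\cdot\mathrm{OFF}$ for every such $G$, initial assignment and request sequence. Theorem. There is an absolute constant $C>0$ such that for every such $V$ and $\ell$, every $\varepsilon\in(0,1/2)$ and every $\alpha>1$, there is a deterministic online algorithm for $\ell$ servers of capacity $(1+\varepsilon)n/\ell$ (augmentation $\varepsilon n/\ell$) that is $\left(C\,\dfrac{\ell\,\log_2 n\,\log_2 \ell}{\varepsilon}\right)$-competitive. -/

import Mathlib

/-! Online learning of a balanced partition of a communication graph on `ℓ` servers. -/

namespace OnlinePartition

/-- An assignment of the vertices to the `ℓ` servers. -/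
abbrev Assignment (V : Type*) (ℓ : ℕ) : Type _ := V → Fin ℓ

section Assignments

variable {V : Type*} [Fintype V] {ℓ : ℕ}

/-- The load of server `j`: the number of vertices assigned to it. -/
def load (a : Assignment V ℓ) (j : Fin ℓ) : ℕ :=
  (Finset.univ.filter fun v => a v = j).card

/-- Every server has load exactly `n / ℓ`. -/
def IsPerfectlyBalanced (a : Assignment V ℓ) : Prop :=
  ∀ j : Fin ℓ, ℓ * load a j = Fintype.card V

/-- Every server has load at most its capacity `(1 + ε) n / ℓ`. -/
def IsValid (ε : ℝ) (a : Assignment V ℓ) : Prop :=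
  ∀ j : Fin ℓ, (load a j : ℝ) ≤ (1 + ε) * (Fintype.card V : ℝ) / (ℓ : ℝ)

/-- The number of vertices that are moved when passing from `a` to `b`. -/
def moves (a b : Assignment V ℓ) : ℕ :=
  (Finset.univ.filter fun v => a v ≠ b v).card

end Assignments

section Model

variable {V : Type*} {ℓ : ℕ}

/-- The communication cost of a request `(u, v)` served under the assignment `a`. -/
def commCost (a : Assignment V ℓ) (e : V × V) : ℕ :=
  if a e.1 = a e.2 then 0 else 1

/-- The vertex sets of the servers are exactly the connected components of `G`. -/
def IsPerfectPartitioning (G : SimpleGraph V) (a : Assignment V ℓ) : Prop :=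
  (Set.range fun j : Fin ℓ => {v | a v = j}) =
    Set.range fun c : G.ConnectedComponent => c.supp

/-- The graph formed by the edges in the request sequence `σ`. -/
def revealedGraph (σ : List (V × V)) : SimpleGraph V :=
  SimpleGraph.fromRel fun u v => (u, v) ∈ σ

/-- The inputs an adversary may present: every connected component of the communication graph `G`
has `n / ℓ` vertices (so that, if `n > 0`, there are exactly `ℓ` of them), every request is an edge
of `G` (repetitions are allowed), and the requests reveal the connected components of `G`. -/
structure IsInput [Fintype V] (ℓ : ℕ) (G : SimpleGraph V) (σ : List (V × V)) : Prop where
  card_component : ∀ c : G.ConnectedComponent, ℓ * c.supp.ncard = Fintype.card V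
  adj_of_mem : ∀ e ∈ σ, G.Adj e.1 e.2
  reveals : ∀ u v : V, (revealedGraph σ).Reachable u v ↔ G.Reachable u v

variable [Fintype V]

/-- A schedule for a request sequence of length `r` is given by assignments `b 0, …, b r`: the
vertices are first moved from the initial assignment to `b 0`; then, for `t = 0, …, r - 1`, request
number `t` is served under `b t`, after which the vertices are moved to `b (t + 1)`. Serving a
request between different servers costs `1`, moving a vertex costs `α`. -/
noncomputable def scheduleCost (α : ℝ) (init : Assignment V ℓ) (σ : List (V × V))
    (b : ℕ → Assignment V ℓ) : ℝ :=
  α * (moves init (b 0) : ℝ) +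
    ∑ t : Fin σ.length,
      ((commCost (b t.1) (σ.get t) : ℝ) + α * (moves (b t.1) (b (t.1 + 1)) : ℝ))

/-- A schedule is feasible if it never exceeds the capacities and ends in a perfect partitioning. -/
def IsFeasible (ε : ℝ) (G : SimpleGraph V) (σ : List (V × V)) (b : ℕ → Assignment V ℓ) : Prop :=
  (∀ t ≤ σ.length, IsValid ε (b t)) ∧ IsPerfectPartitioning G (b σ.length)

/-- The cost of an optimal offline algorithm: the least cost of a feasible schedule, which may be
chosen with full knowledge of `G` and `σ`. -/
noncomputable def offlineCost (α ε : ℝ) (G : SimpleGraph V) (init : Assignment V ℓ)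
    (σ : List (V × V)) : ℝ :=
  sInf {c : ℝ | ∃ b : ℕ → Assignment V ℓ, IsFeasible ε G σ b ∧ c = scheduleCost α init σ b}

end Model

/-- A deterministic online algorithm: given the initial assignment and the requests seen so far, it
determines the current assignment. It does not see the graph or future requests. -/
abbrev OnlineAlgorithm (V : Type*) (ℓ : ℕ) : Type _ :=
  Assignment V ℓ → List (V × V) → Assignment V ℓ

/-- The schedule that an online algorithm produces on the request sequence `σ`. -/
def OnlineAlgorithm.schedule {V : Type*} {ℓ : ℕ} (A : OnlineAlgorithm V ℓ)
    (init : Assignment V ℓ) (σ : List (V × V)) : ℕ → Assignment V ℓ :=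
  fun t => A init (σ.take t)

/-- `A` is (strictly) `ρ`-competitive on servers of capacity `(1 + ε) n / ℓ`: from every perfectly
balanced initial assignment and on every input it respects the capacities, ends in a perfect
partitioning, and pays at most `ρ` times the optimal offline cost. -/
def OnlineAlgorithm.IsCompetitive {V : Type*} [Fintype V] {ℓ : ℕ} (A : OnlineAlgorithm V ℓ)
    (α ε ρ : ℝ) : Prop :=
  ∀ (G : SimpleGraph V) (init : Assignment V ℓ) (σ : List (V × V)),
    IsPerfectlyBalanced init → IsInput ℓ G σ →
      IsFeasible ε G σ (A.schedule init σ) ∧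
        scheduleCost α init σ (A.schedule init σ) ≤ ρ * offlineCost α ε G init σ

end OnlinePartition

/-! Compare with any feasible schedule, let `f` be its final assignment and `D = moves init f`; by
the triangle inequality the schedule pays at least `α * D`. Everything else bounds the algorithm's
cost by `D`.

Let `S` count the vertices carried along when a smaller cluster joins a larger one on another
server. The sum of log cluster sizes pays for `S`, so `S ≤ n log n` always
(`potential_add_le_potential_join`). Until the first rebalancing more is true: a cluster not on its
server in `f` has at least a quarter of its vertices among the `D` vertices with `init ≠ f`, because
clusters are settled. A costly merge joins two clusters that `f` puts together, so one of them is
misplaced, and the potential restricted to those `D` vertices already pays: `S ≤ 4 D log n`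
(`Bookkeeping.absorb`).

An overflow means that the assignment has drifted by more than `ε n / ℓ` from the reference. Drift
is paid from `S`, so there are at most `X = ℓ log n / ε` rebalancings. At the first one, settledness
bounds the drift by `4 D`, hence `D ≥ ε n / (4 ℓ)`, and now even `n log n` is at most `4 X D`. A
rebalancing costs the drift plus `2 D`, since the old and new references are both within `D` of
`init` (`Bookkeeping.rebalance`). -/

namespace OnlinePartition

/-! ### Distances between assignments and the overflow threshold. -/

section Distances

variable {V : Type*} [Fintype V] {ℓ : ℕ}

theorem moves_self (a : Assignment V ℓ) : moves a a = 0 := by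
  simp [moves]

theorem moves_comm (a b : Assignment V ℓ) : moves a b = moves b a := by
  simp only [moves, ne_comm]

theorem moves_triangle (a b c : Assignment V ℓ) : moves a c ≤ moves a b + moves b c := by
  classical
  unfold moves
  refine (Finset.card_le_card ?_).trans (Finset.card_union_le _ _)
  intro x
  simp only [Finset.mem_filter, Finset.mem_univ, true_and, Finset.mem_union]
  intro h
  by_contra! h'
  exact h (h'.1.trans h'.2)

theorem load_le_load_add_moves (a b : Assignment V ℓ) (j : Fin ℓ) :
    load b j ≤ load a j + moves a b := by
  classical
  unfold load moves
  refine (Finset.card_le_card ?_).trans (Finset.card_union_le _ _)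
  intro x
  simp only [Finset.mem_filter, Finset.mem_univ, true_and, Finset.mem_union]
  intro h
  by_cases h' : a x = j
  · exact Or.inl h'
  · exact Or.inr fun h'' => h' (h''.trans h)

theorem IsPerfectlyBalanced.load_eq {a : Assignment V ℓ} (ha : IsPerfectlyBalanced a) (j : Fin ℓ) :
    (load a j : ℝ) = (Fintype.card V : ℝ) / ℓ := by
  have hl : (ℓ : ℝ) ≠ 0 := by
    have : 0 < ℓ := j.pos
    positivity
  rw [eq_div_iff hl, mul_comm]
  exact_mod_cast ha j

theorem IsPerfectlyBalanced.isValid {a : Assignment V ℓ} (ha : IsPerfectlyBalanced a) {ε : ℝ}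
    (hε : 0 ≤ ε) : IsValid ε a := by
  intro j
  rw [ha.load_eq j, mul_div_assoc]
  exact le_mul_of_one_le_left (by positivity) (by linarith)

/-- An assignment that exceeds a capacity is far from every perfectly balanced one. -/
theorem lt_moves_of_not_isValid {r a : Assignment V ℓ} (hr : IsPerfectlyBalanced r) {ε : ℝ}
    (ha : ¬ IsValid ε a) : ε * ((Fintype.card V : ℝ) / ℓ) < moves r a := by
  simp only [IsValid, not_forall, not_le] at ha
  obtain ⟨j, hj⟩ := ha
  have h : (load a j : ℝ) ≤ load r j + moves r a := by exact_mod_cast load_le_load_add_moves r a j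
  rw [hr.load_eq j] at h
  rw [mul_div_assoc] at hj
  linarith

end Distances

/-! ### Cluster labellings, joining and relocating. -/

section Labels

variable {V : Type*} {ℓ : ℕ}

open Classical in
/-- The labelling in which the cluster of `u` has been absorbed by the cluster of `v`. -/
noncomputable def join (c : V → V) (u v : V) : V → V :=
  fun x => if c x = c u then c v else c x

theorem join_eq_of_eq {c : V → V} (u v : V) {x y : V} (h : c x = c y) :
    join c u v x = join c u v y := by
  unfold join
  rw [h]

theorem join_left (c : V → V) (u v : V) : join c u v u = c v := by simp [join]

theorem join_right (c : V → V) (u v : V) : join c u v v = c v := by simp [join]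

theorem join_eq_right_iff {c : V → V} {u v x : V} :
    join c u v x = join c u v v ↔ c x = c u ∨ c x = c v := by
  rw [join_right]
  by_cases h : c x = c u <;> simp [join, h]

theorem join_eq_iff_of_ne {c : V → V} {u v x y : V} (h₁ : c x ≠ c u) (h₂ : c x ≠ c v) :
    join c u v y = join c u v x ↔ c y = c x := by
  by_cases h : c y = c u
  · simp [join, h, h₁, Ne.symm h₁, Ne.symm h₂]
  · simp [join, h, h₁]

/-- A relation that is coarser than the clusters and relates `u` and `v` is coarser than the joined
clusters. -/
theorem rel_of_join_eq {β : Type*} {c : V → V} {g : V → β} {u v : V}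
    (h : ∀ x y, c x = c y → g x = g y) (huv : g u = g v) {x y : V}
    (hxy : join c u v x = join c u v y) : g x = g y := by
  by_cases hx : c x = c u ∨ c x = c v
  · have hy : c y = c u ∨ c y = c v :=
      join_eq_right_iff.1 (hxy.symm.trans (join_eq_right_iff.2 hx))
    have key : ∀ z, c z = c u ∨ c z = c v → g z = g v := fun z hz =>
      hz.elim (fun hz => (h _ _ hz).trans huv) (h _ _)
    exact (key x hx).trans (key y hy).symm
  · push Not at hx
    exact (h _ _ ((join_eq_iff_of_ne hx.1 hx.2).1 hxy.symm)).symm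

open Classical in
/-- Move the cluster of `v` to server `j`. -/
noncomputable def relocate (c : V → V) (a : Assignment V ℓ) (v : V) (j : Fin ℓ) : Assignment V ℓ :=
  fun x => if c x = c v then j else a x

theorem relocate_of_eq {c : V → V} (a : Assignment V ℓ) {v x : V} (j : Fin ℓ) (h : c x = c v) :
    relocate c a v j x = j := by
  simp [relocate, h]

theorem relocate_of_ne {c : V → V} (a : Assignment V ℓ) {v x : V} (j : Fin ℓ) (h : c x ≠ c v) :
    relocate c a v j x = a x := by
  simp [relocate, h]

theorem relocate_eq_self {c : V → V} {a : Assignment V ℓ} {v : V}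
    (ha : ∀ x, c x = c v → a x = a v) : relocate c a v (a v) = a := by
  funext x
  by_cases h : c x = c v
  · rw [relocate_of_eq a _ h, ha x h]
  · exact relocate_of_ne a _ h

theorem relocate_const {c : V → V} {a : Assignment V ℓ} (ha : ∀ x y, c x = c y → a x = a y)
    (v : V) (j : Fin ℓ) {x y : V} (h : c x = c y) : relocate c a v j x = relocate c a v j y := by
  unfold relocate
  rw [h, ha x y h]

end Labels

/-! ### The logarithmic potential and settling of clusters. -/

section Clusters

variable {V : Type*} [Fintype V] {ℓ : ℕ}

open Classical in
/-- The vertices that carry the same label as `x`. -/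
noncomputable def cluster (c : V → V) (x : V) : Finset V :=
  Finset.univ.filter fun y => c y = c x

theorem mem_cluster {c : V → V} {x y : V} : y ∈ cluster c x ↔ c y = c x := by
  simp [cluster]

theorem cluster_congr {c : V → V} {x y : V} (h : c x = c y) : cluster c x = cluster c y := by
  ext z
  simp only [mem_cluster, h]

theorem cluster_card_pos (c : V → V) (x : V) : 0 < (cluster c x).card :=
  Finset.card_pos.2 ⟨x, mem_cluster.2 rfl⟩

theorem card_cluster_join {c : V → V} {u v x : V} (huv : c u ≠ c v) (hx : c x = c u ∨ c x = c v) :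
    (cluster (join c u v) x).card = (cluster c u).card + (cluster c v).card := by
  classical
  rw [cluster_congr (join_eq_right_iff.2 hx), ← Finset.card_union_of_disjoint]
  · congr 1
    ext y
    simp only [mem_cluster, join_eq_right_iff, Finset.mem_union]
  · rw [Finset.disjoint_left]
    intro y hy hy'
    rw [mem_cluster] at hy hy'
    exact huv (hy.symm.trans hy')

theorem cluster_join_of_ne {c : V → V} {u v x : V} (h₁ : c x ≠ c u) (h₂ : c x ≠ c v) :
    cluster (join c u v) x = cluster c x := by
  ext y
  simp only [mem_cluster, join_eq_iff_of_ne h₁ h₂]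

/-- The sum over `W` of the logarithms of the cluster sizes. -/
noncomputable def potential (c : V → V) (W : Finset V) : ℝ :=
  ∑ x ∈ W, Real.logb 2 ((cluster c x).card : ℝ)

theorem potential_le (c : V → V) (W : Finset V) :
    potential c W ≤ W.card * Real.logb 2 (Fintype.card V : ℝ) := by
  unfold potential
  rw [← nsmul_eq_mul]
  refine Finset.sum_le_card_nsmul _ _ _ fun x _ => ?_
  refine Real.logb_le_logb_of_le one_lt_two (by exact_mod_cast cluster_card_pos c x) ?_
  exact_mod_cast Finset.card_le_univ _

theorem potential_nonneg (c : V → V) (W : Finset V) : 0 ≤ potential c W := by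
  refine Finset.sum_nonneg fun x _ => Real.logb_nonneg one_lt_two ?_
  exact_mod_cast cluster_card_pos c x

/-- With `t = p / q` in `[0, 1]` this is `2 ^ t ≤ 1 + t`, Bernoulli's inequality for exponents at
most one. -/
theorem div_le_logb_two_sub {p q : ℝ} (hp : 0 < p) (hq : 0 < q) (hpq : p ≤ q) :
    p / q ≤ Real.logb 2 (p + q) - Real.logb 2 q := by
  rw [← Real.logb_div (by positivity) hq.ne', Real.le_logb_iff_rpow_le one_lt_two (by positivity)]
  have h := rpow_one_add_le_one_add_mul_self (s := 1) (by norm_num)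
    (show 0 ≤ p / q by positivity) ((div_le_one hq).2 hpq)
  calc (2 : ℝ) ^ (p / q) = (1 + 1) ^ (p / q) := by norm_num
    _ ≤ 1 + p / q * 1 := h
    _ = (p + q) / q := by field_simp; ring

/-- A vertex of the smaller cluster sees its cluster at least double and gains at least 1; a vertex
of the larger one gains at least the ratio of the sizes. The second gain is needed when only the
larger cluster is rich in vertices of `W`. -/
theorem potential_add_le_potential_join {c : V → V} {u v : V} (huv : c u ≠ c v)
    (hle : (cluster c u).card ≤ (cluster c v).card) (W : Finset V) [DecidableEq V] :
    potential c W + ((W ∩ cluster c u).card +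
      (W ∩ cluster c v).card * ((cluster c u).card / (cluster c v).card : ℝ)) ≤
        potential (join c u v) W := by
  have hA : (0 : ℝ) < (cluster c u).card := by exact_mod_cast cluster_card_pos c u
  have hB : (0 : ℝ) < (cluster c v).card := by exact_mod_cast cluster_card_pos c v
  have hAB : ((cluster c u).card : ℝ) ≤ (cluster c v).card := by exact_mod_cast hle
  set q : ℝ := (cluster c u).card / (cluster c v).card with hq
  have e₁ : ((W ∩ cluster c u).card : ℝ) = ∑ x ∈ W, if x ∈ cluster c u then 1 else 0 := by
    rw [Finset.sum_ite_mem]; simp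
  have e₂ : ((W ∩ cluster c v).card * q : ℝ) = ∑ x ∈ W, if x ∈ cluster c v then q else 0 := by
    rw [Finset.sum_ite_mem]; simp
  rw [e₁, e₂]
  unfold potential
  rw [← Finset.sum_add_distrib, ← Finset.sum_add_distrib]
  refine Finset.sum_le_sum fun x _ => ?_
  by_cases hxu : c x = c u
  · have hxv : c x ≠ c v := fun h => huv (hxu.symm.trans h)
    rw [card_cluster_join huv (Or.inl hxu), if_pos (mem_cluster.2 hxu),
      if_neg (fun h => hxv (mem_cluster.1 h)), cluster_congr hxu]
    have h := div_le_logb_two_sub hA hA le_rfl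
    have h' : Real.logb 2 ((cluster c u).card + (cluster c u).card : ℝ) ≤
        Real.logb 2 ((cluster c u).card + (cluster c v).card : ℝ) :=
      Real.logb_le_logb_of_le one_lt_two (by positivity) (by linarith)
    rw [div_self hA.ne'] at h
    push_cast
    linarith
  · by_cases hxv : c x = c v
    · rw [card_cluster_join huv (Or.inr hxv), if_pos (mem_cluster.2 hxv),
        if_neg (fun h => hxu (mem_cluster.1 h)), cluster_congr hxv]
      have h := div_le_logb_two_sub hA hB hAB
      push_cast
      linarith
    · rw [cluster_join_of_ne hxu hxv, if_neg (fun h => hxu (mem_cluster.1 h)),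
        if_neg (fun h => hxv (mem_cluster.1 h))]
      simp

theorem moves_relocate_le (c : V → V) (a : Assignment V ℓ) (v : V) (j : Fin ℓ) :
    moves a (relocate c a v j) ≤ (cluster c v).card := by
  refine Finset.card_le_card fun x hx => ?_
  simp only [Finset.mem_filter, Finset.mem_univ, true_and] at hx
  by_contra h
  exact hx (relocate_of_ne a j fun h' => h (mem_cluster.2 h')).symm

/-- Moving a cluster to the server that holds more than three quarters of it in `r` brings the
assignment closer to `r`. -/
theorem moves_relocate_add_le {c : V → V} {r a : Assignment V ℓ} {v : V} {p : Fin ℓ}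
    (ha : ∀ x, c x = c v → a x = a v)
    (hp : 3 * (cluster c v).card < 4 * ((cluster c v).filter fun y => r y = p).card) :
    moves a (relocate c a v p) + 2 * moves r (relocate c a v p) ≤ 2 * moves r a := by
  classical
  by_cases hav : a v = p
  · subst hav
    rw [relocate_eq_self ha, moves_self, zero_add]
  · have h₁ := moves_relocate_le c a v p
    -- Only the cluster matters: its vertices with `r = p` were all misplaced before, and afterwards
    -- only the others are. The distance drops by more than half the cluster, while at most the
    -- whole cluster moves; hence the factor 2.
    have h₂ : moves r (relocate c a v p) + ((cluster c v).filter fun y => r y = p).card ≤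
        moves r a + ((cluster c v).filter fun y => ¬ r y = p).card := by
      unfold moves
      rw [← Finset.card_filter_add_card_filter_not (s := Finset.univ.filter fun x => r x ≠ a x)
          (fun x => c x = c v),
        ← Finset.card_filter_add_card_filter_not
          (s := Finset.univ.filter fun x => r x ≠ relocate c a v p x) (fun x => c x = c v)]
      have i₁ : ((cluster c v).filter fun y => r y = p).card ≤
          ((Finset.univ.filter fun x => r x ≠ a x).filter fun x => c x = c v).card := by
        refine Finset.card_le_card fun x hx => ?_
        simp only [Finset.mem_filter, Finset.mem_univ, true_and, mem_cluster] at hx ⊢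
        refine ⟨fun h => hav ?_, hx.1⟩
        rw [← ha x hx.1, ← h, hx.2]
      have i₂ : ((Finset.univ.filter fun x => r x ≠ relocate c a v p x).filter
          fun x => c x = c v).card ≤ ((cluster c v).filter fun y => ¬ r y = p).card := by
        refine Finset.card_le_card fun x hx => ?_
        simp only [Finset.mem_filter, Finset.mem_univ, true_and, mem_cluster] at hx ⊢
        rw [relocate_of_eq a p hx.2] at hx
        exact ⟨hx.2, hx.1⟩
      have i₃ : ((Finset.univ.filter fun x => r x ≠ relocate c a v p x).filter
          fun x => ¬ c x = c v).card ≤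
          ((Finset.univ.filter fun x => r x ≠ a x).filter fun x => ¬ c x = c v).card := by
        refine Finset.card_le_card fun x hx => ?_
        simp only [Finset.mem_filter, Finset.mem_univ, true_and] at hx ⊢
        rw [relocate_of_ne a p hx.2] at hx
        exact hx
      omega
    have h₃ := Finset.card_filter_add_card_filter_not (s := cluster c v) (fun y => r y = p)
    omega

open Classical in
/-- If some server holds more than three quarters of the cluster of `v` in the reference assignment
`r`, move that cluster there. -/
noncomputable def settle (c : V → V) (r a : Assignment V ℓ) (v : V) : Assignment V ℓ :=
  if h : ∃ p, 3 * (cluster c v).card < 4 * ((cluster c v).filter fun y => r y = p).card then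
    relocate c a v h.choose
  else a

theorem settle_const {c : V → V} {a : Assignment V ℓ} (ha : ∀ x y, c x = c y → a x = a y)
    (r : Assignment V ℓ) (v : V) {x y : V} (h : c x = c y) :
    settle c r a v x = settle c r a v y := by
  unfold settle
  split_ifs
  · exact relocate_const ha _ _ h
  · exact ha x y h

theorem settle_of_ne {c : V → V} (r a : Assignment V ℓ) {v x : V} (h : c x ≠ c v) :
    settle c r a v x = a x := by
  unfold settle
  split_ifs
  · exact relocate_of_ne a _ h
  · rfl

theorem moves_settle_add_le {c : V → V} {r a : Assignment V ℓ} {v : V}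
    (ha : ∀ x, c x = c v → a x = a v) :
    moves a (settle c r a v) + 2 * moves r (settle c r a v) ≤ 2 * moves r a := by
  unfold settle
  split_ifs with h
  · exact moves_relocate_add_le ha h.choose_spec
  · rw [moves_self, zero_add]

/-- Either no server holds more than three quarters, or the cluster sits on the one that does and
less than a quarter remains for any other. -/
theorem card_filter_le_of_settle {c : V → V} (r a : Assignment V ℓ) {v x : V} (hx : c x = c v)
    {p : Fin ℓ} (hp : p ≠ settle c r a v x) :
    4 * ((cluster c x).filter fun y => r y = p).card ≤ 3 * (cluster c x).card := by
  rw [cluster_congr hx]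
  unfold settle at hp
  split_ifs at hp with h
  · rw [relocate_of_eq a _ hx] at hp
    have h₁ := h.choose_spec
    have h₂ : ((cluster c v).filter fun y => r y = p).card ≤
        ((cluster c v).filter fun y => ¬ r y = h.choose).card := by
      refine Finset.card_le_card fun y hy => ?_
      simp only [Finset.mem_filter] at hy ⊢
      exact ⟨hy.1, fun h' => hp (hy.2.symm.trans h')⟩
    have h₃ := Finset.card_filter_add_card_filter_not (s := cluster c v) (fun y => r y = h.choose)
    omega
  · push Not at h
    exact h p

/-- If no cluster lies on a server other than the one that holds more than three quarters of it in
`r`, then the assignment is almost as close to `r` as any assignment that separates no cluster. -/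
theorem moves_le_four_mul_moves {c : V → V} {r a f : Assignment V ℓ}
    (ha : ∀ x y, c x = c y → a x = a y) (hf : ∀ x y, c x = c y → f x = f y)
    (h : ∀ x, ∀ p, p ≠ a x →
      4 * ((cluster c x).filter fun y => r y = p).card ≤ 3 * (cluster c x).card) :
    moves r a ≤ 4 * moves r f := by
  classical
  unfold moves
  rw [Finset.card_eq_sum_card_fiberwise (f := c) (t := Finset.univ) (by simp),
    Finset.card_eq_sum_card_fiberwise (s := Finset.univ.filter fun x => r x ≠ f x) (f := c)
      (t := Finset.univ) (by simp), Finset.mul_sum]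
  refine Finset.sum_le_sum fun b _ => ?_
  by_cases hb : ∃ x, c x = b
  · obtain ⟨x, rfl⟩ := hb
    have e : ∀ g : Assignment V ℓ, (∀ x y, c x = c y → g x = g y) →
        (Finset.univ.filter fun y => r y ≠ g y).filter (fun y => c y = c x) =
          (cluster c x).filter fun y => ¬ r y = g x := by
      intro g hg
      ext y
      simp only [Finset.mem_filter, Finset.mem_univ, true_and, mem_cluster]
      constructor
      · rintro ⟨h₁, h₂⟩
        exact ⟨h₂, hg y x h₂ ▸ h₁⟩
      · rintro ⟨h₁, h₂⟩
        exact ⟨(hg y x h₁).symm ▸ h₂, h₁⟩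
    rw [e a ha, e f hf]
    by_cases hx : f x = a x
    · rw [hx]; omega
    -- A cluster placed differently by `f` has at least a quarter of its vertices off `f x` in `r`,
    -- and at most all of them off `a x`.
    · have h₁ := h x (f x) hx
      have h₂ := Finset.card_filter_add_card_filter_not (s := cluster c x) (fun y => r y = f x)
      have h₃ := Finset.card_filter_le (cluster c x) (fun y => ¬ r y = a x)
      omega
  · rw [Finset.card_eq_zero.2]
    · omega
    · ext y
      simp only [Finset.mem_filter, Finset.notMem_empty, iff_false, not_and]
      exact fun _ h' => hb ⟨y, h'⟩

end Clusters

/-! ### The algorithm, its invariant and the resulting cost bound. -/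

section Algorithm

variable {V : Type*} [Fintype V] {ℓ : ℕ}

/-- The memory of the algorithm: a labelling of the vertices by the components revealed so far, the
current assignment, and the perfectly balanced assignment chosen at the last rebalancing. -/
structure State (V : Type*) (ℓ : ℕ) where
  comp : V → V
  cur : Assignment V ℓ
  ref : Assignment V ℓ

/-- A perfectly balanced assignment that separates no cluster, with as few moves from `init` as
possible. -/
def IsNearest (init : Assignment V ℓ) (c : V → V) (b : Assignment V ℓ) : Prop :=
  IsPerfectlyBalanced b ∧ (∀ x y, c x = c y → b x = b y) ∧
    ∀ b', IsPerfectlyBalanced b' → (∀ x y, c x = c y → b' x = b' y) → moves init b ≤ moves init b'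

open Classical in
/-- A nearest perfectly balanced assignment that separates no cluster, if there is one. -/
noncomputable def nearest (init : Assignment V ℓ) (c : V → V) : Assignment V ℓ :=
  if h : ∃ b, IsNearest init c b then h.choose else init

/-- The competitor's `f` is itself a candidate, so the default value in `nearest` is not reached and
the chosen assignment is no farther from `init` than `f`. -/
theorem isNearest_nearest {c : V → V} {f : Assignment V ℓ} (init : Assignment V ℓ)
    (hbal : IsPerfectlyBalanced f) (hf : ∀ x y, c x = c y → f x = f y) :
    IsNearest init c (nearest init c) := by
  have h : ∃ b, IsNearest init c b := by
    obtain ⟨b, hb, hmin⟩ := Set.exists_min_image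
      {b | IsPerfectlyBalanced b ∧ ∀ x y, c x = c y → b x = b y} (moves init) (Set.toFinite _)
      ⟨f, hbal, hf⟩
    exact ⟨b, hb.1, hb.2, fun b' h₁ h₂ => hmin b' ⟨h₁, h₂⟩⟩
  rw [nearest, dif_pos h]
  exact h.choose_spec

/-- The assignment after the cluster of `u` has been moved to the server of `v` and the joined
cluster has been settled. -/
noncomputable def State.absorb (s : State V ℓ) (u v : V) : Assignment V ℓ :=
  settle (join s.comp u v) s.ref (relocate s.comp s.cur u (s.cur v)) v

open Classical in
/-- Join the cluster of `u` to that of `v`, and rebalance if this exceeds a capacity. -/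
noncomputable def State.merge (ε : ℝ) (init : Assignment V ℓ) (s : State V ℓ) (u v : V) :
    State V ℓ :=
  if IsValid ε (s.absorb u v) then ⟨join s.comp u v, s.absorb u v, s.ref⟩
  else ⟨join s.comp u v, nearest init (join s.comp u v), nearest init (join s.comp u v)⟩

open Classical in
/-- Process a request: the smaller of the two clusters joins the larger one. -/
noncomputable def State.step (ε : ℝ) (init : Assignment V ℓ) (s : State V ℓ) (e : V × V) :
    State V ℓ :=
  if s.comp e.1 = s.comp e.2 then s
  else if (cluster s.comp e.1).card ≤ (cluster s.comp e.2).card then s.merge ε init e.1 e.2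
  else s.merge ε init e.2 e.1

/-- The state after the requests `σ`. -/
noncomputable def State.run (ε : ℝ) (init : Assignment V ℓ) (σ : List (V × V)) : State V ℓ :=
  σ.foldl (State.step ε init) ⟨id, init, init⟩

theorem State.run_append (ε : ℝ) (init : Assignment V ℓ) (σ : List (V × V)) (e : V × V) :
    State.run ε init (σ ++ [e]) = (State.run ε init σ).step ε init e := by
  simp [State.run]

/-- The algorithm: clusters are joined small to large, each is kept on the server that holds most of
it in the reference assignment, and an overflow triggers a rebalancing. -/
noncomputable def smallToLarge (V : Type*) [Fintype V] (ℓ : ℕ) (ε : ℝ) : OnlineAlgorithm V ℓ :=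
  fun init σ => (State.run ε init σ).cur

theorem State.merge_comp (ε : ℝ) (init : Assignment V ℓ) (s : State V ℓ) (u v : V) :
    (s.merge ε init u v).comp = join s.comp u v := by
  unfold State.merge
  split_ifs <;> rfl

theorem State.step_comp_of_eq (ε : ℝ) (init : Assignment V ℓ) (s : State V ℓ) (e : V × V) {x y : V}
    (h : s.comp x = s.comp y) : (s.step ε init e).comp x = (s.step ε init e).comp y := by
  unfold State.step
  split_ifs
  · exact h
  all_goals
    rw [State.merge_comp]
    exact join_eq_of_eq _ _ h

theorem State.step_comp_request (ε : ℝ) (init : Assignment V ℓ) (s : State V ℓ) (e : V × V) :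
    (s.step ε init e).comp e.1 = (s.step ε init e).comp e.2 := by
  unfold State.step
  split_ifs with h
  · exact h
  all_goals rw [State.merge_comp, join_left, join_right]

/-- The invariant of the algorithm, relative to an assignment `f` that no request contradicts. Here
`K` bounds the communication cost and `M` the number of moves, `S` counts the vertices of smaller
clusters that were moved to the server of a larger one, and `R` counts the rebalancings. -/
structure Bookkeeping (ε : ℝ) (init f : Assignment V ℓ) (s : State V ℓ) (K M S R : ℕ) : Prop where
  comp_le : ∀ x y, s.comp x = s.comp y → f x = f y
  cur_const : ∀ x y, s.comp x = s.comp y → s.cur x = s.cur y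
  ref_balanced : IsPerfectlyBalanced s.ref
  ref_near : moves init s.ref ≤ moves init f
  settled : ∀ x, ∀ p, p ≠ s.cur x →
    4 * ((cluster s.comp x).filter fun y => s.ref y = p).card ≤ 3 * (cluster s.comp x).card
  small_le : (S : ℝ) ≤ potential s.comp Finset.univ
  ref_eq : R = 0 → s.ref = init
  small_le_of_eq : R = 0 → (S : ℝ) ≤ 4 * potential s.comp (Finset.univ.filter fun x => init x ≠ f x)
  drift : R * (ε * ((Fintype.card V : ℝ) / ℓ)) + moves s.ref s.cur ≤ S
  far : R ≠ 0 → ε * ((Fintype.card V : ℝ) / ℓ) ≤ 4 * moves init f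
  moves_le : M + 2 * moves s.ref s.cur ≤ 3 * S + 2 * moves init f * R
  comm_le : K ≤ S

variable {ε : ℝ} {init f : Assignment V ℓ} {s : State V ℓ} {K M S R : ℕ}

theorem Bookkeeping.mono {M' : ℕ} (h : Bookkeeping ε init f s K M S R) (hM : M' ≤ M) :
    Bookkeeping ε init f s K M' S R :=
  { h with moves_le := (Nat.add_le_add_right hM _).trans h.moves_le }

theorem bookkeeping_start (hinit : IsPerfectlyBalanced init) :
    Bookkeeping ε init f ⟨id, init, init⟩ 0 0 0 0 where
  comp_le x y h := congrArg f h
  cur_const x y h := congrArg init h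
  ref_balanced := hinit
  ref_near := by simp [moves_self]
  settled x p hp := by
    rw [Finset.card_eq_zero.2]
    · omega
    · refine Finset.filter_eq_empty_iff.2 fun y hy h => hp ?_
      rw [← h, show y = x from mem_cluster.1 hy]
  small_le := by simpa using potential_nonneg _ _
  ref_eq _ := rfl
  small_le_of_eq _ := by simpa using potential_nonneg _ _
  drift := by simp [moves_self]
  far h := absurd rfl h
  moves_le := by simp [moves_self]
  comm_le := le_rfl

/-- A cluster on a server other than the one it has in `f` has many vertices that must move. -/
theorem Bookkeeping.card_cluster_le [DecidableEq V] (h : Bookkeeping ε init f s K M S R)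
    (hR : R = 0) {x : V} (hx : f x ≠ s.cur x) :
    (cluster s.comp x).card ≤
      4 * ((Finset.univ.filter fun x => init x ≠ f x) ∩ cluster s.comp x).card := by
  have h₁ := h.settled x (f x) hx
  rw [h.ref_eq hR] at h₁
  have h₂ := Finset.card_filter_add_card_filter_not (s := cluster s.comp x) (fun y => init y = f x)
  have h₃ : ((cluster s.comp x).filter fun y => ¬ init y = f x).card ≤
      ((Finset.univ.filter fun x => init x ≠ f x) ∩ cluster s.comp x).card := by
    refine Finset.card_le_card fun y hy => ?_
    simp only [Finset.mem_filter, Finset.mem_inter, Finset.mem_univ, true_and] at hy ⊢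
    exact ⟨h.comp_le y x (mem_cluster.1 hy.1) ▸ hy.2, hy.1⟩
  omega

/-- The charge to `S` is `m`, the size of the smaller cluster if it changes server and 0 otherwise.
Relocation costs at most `m` and adds at most `m` to the distance from `ref`; settling is paid by
twice the distance it saves. This gives the `3 * S` in `moves_le`. -/
theorem Bookkeeping.absorb (h : Bookkeeping ε init f s K M S R) {u v : V}
    (huv : s.comp u ≠ s.comp v) (hf : f u = f v)
    (hle : (cluster s.comp u).card ≤ (cluster s.comp v).card) :
    ∃ S', Bookkeeping ε init f ⟨join s.comp u v, s.absorb u v, s.ref⟩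
      (K + commCost s.cur (u, v)) (M + moves s.cur (s.absorb u v)) S' R := by
  classical
  set a := relocate s.comp s.cur u (s.cur v) with ha
  set m := if s.cur u = s.cur v then 0 else (cluster s.comp u).card with hm
  have hconst : ∀ x y, join s.comp u v x = join s.comp u v y → a x = a y := fun x y hxy =>
    rel_of_join_eq (fun x y hxy => relocate_const h.cur_const u (s.cur v) hxy)
      (by rw [relocate_of_eq _ _ rfl, relocate_of_ne _ _ huv.symm]) hxy
  have hma : moves s.cur a ≤ m := by
    rw [hm]
    split_ifs with h'
    · rw [ha, ← h', relocate_eq_self fun x hx => h.cur_const x u hx, moves_self]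
    · exact moves_relocate_le _ _ _ _
  have hset : moves a (s.absorb u v) + 2 * moves s.ref (s.absorb u v) ≤ 2 * moves s.ref a :=
    moves_settle_add_le fun x hx => hconst x v hx
  have htri := moves_triangle s.ref s.cur a
  have htri' := moves_triangle s.cur a (s.absorb u v)
  have hcomm : commCost s.cur (u, v) ≤ m := by
    rw [hm]
    unfold commCost
    split_ifs
    · exact le_rfl
    · exact cluster_card_pos _ _
  have hdrift : moves s.ref (s.absorb u v) ≤ moves s.ref s.cur + m := by omega
  have hA : (0 : ℝ) < (cluster s.comp u).card := by exact_mod_cast cluster_card_pos s.comp u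
  have hB : (0 : ℝ) < (cluster s.comp v).card := by exact_mod_cast cluster_card_pos s.comp v
  have hpot := potential_add_le_potential_join huv hle
  have hnn : ∀ W : Finset V, 0 ≤ ((W ∩ cluster s.comp v).card *
      ((cluster s.comp u).card / (cluster s.comp v).card : ℝ)) := fun W => by positivity
  refine ⟨S + m, ?_⟩
  constructor
  · exact fun x y => rel_of_join_eq h.comp_le hf
  · exact fun x y => settle_const hconst _ _
  · exact h.ref_balanced
  · exact h.ref_near
  · intro x p hp
    by_cases hx : join s.comp u v x = join s.comp u v v
    · exact card_filter_le_of_settle _ _ hx hp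
    · have hx' : s.comp x ≠ s.comp u ∧ s.comp x ≠ s.comp v := by
        simpa [join_eq_right_iff] using hx
      simp only [State.absorb] at hp
      rw [settle_of_ne _ _ hx, relocate_of_ne _ _ hx'.1] at hp
      simp only
      rw [cluster_join_of_ne hx'.1 hx'.2]
      exact h.settled x p hp
  · have h₁ := hpot Finset.univ
    have h₂ := hnn Finset.univ
    rw [Finset.univ_inter] at h₁
    have h₃ : (m : ℝ) ≤ (cluster s.comp u).card := by
      rw [hm]
      split_ifs
      · simp
      · exact le_rfl
    have h₄ := h.small_le
    push_cast
    linarith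
  · exact h.ref_eq
  · intro hR
    have h₁ := hpot (Finset.univ.filter fun x => init x ≠ f x)
    have h₂ := hnn (Finset.univ.filter fun x => init x ≠ f x)
    have h₄ := h.small_le_of_eq hR
    have h₅ : (0 : ℝ) ≤
      ((Finset.univ.filter fun x => init x ≠ f x) ∩ cluster s.comp u).card := by positivity
    by_cases huv' : s.cur u = s.cur v
    · have : m = 0 := by simp [hm, huv']
      simp only [this, add_zero]
      linarith
    · have hm' : (m : ℝ) = (cluster s.comp u).card := by simp [hm, huv']
      push_cast
      rw [hm']
      -- As `f u = f v` but the servers differ, one of the two clusters is misplaced and has a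
      -- quarter of its vertices in the restricted set. Either way the restricted potential grows by
      -- at least a quarter of the smaller cluster.
      by_cases hu : f u = s.cur u
      · have hv : f v ≠ s.cur v := fun hv => huv' (by rw [← hu, ← hv, hf])
        have h₆ : ((cluster s.comp v).card : ℝ) ≤
            4 * ((Finset.univ.filter fun x => init x ≠ f x) ∩ cluster s.comp v).card := by
          exact_mod_cast h.card_cluster_le hR hv
        have h₇ := mul_le_mul_of_nonneg_right h₆ (div_pos hA hB).le
        rw [mul_div_cancel₀ _ hB.ne'] at h₇
        linarith
      · have h₆ : ((cluster s.comp u).card : ℝ) ≤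
            4 * ((Finset.univ.filter fun x => init x ≠ f x) ∩ cluster s.comp u).card := by
          exact_mod_cast h.card_cluster_le hR hu
        linarith
  · have h₁ : (moves s.ref (s.absorb u v) : ℝ) ≤ moves s.ref s.cur + m := by exact_mod_cast hdrift
    have h₂ := h.drift
    push_cast
    linarith
  · exact h.far
  · have h₁ := h.moves_le
    simp only
    omega
  · have h₁ := h.comm_le
    omega

/-- The drift, which exceeds `ε n / ℓ`, is converted into one unit of `R` and reset to zero. The way
back through `ref` and `init` costs at most the drift plus `2 D`. -/
theorem Bookkeeping.rebalance (h : Bookkeeping ε init f s K M S R) (hf : IsPerfectlyBalanced f)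
    (hs : ¬ IsValid ε s.cur) :
    Bookkeeping ε init f ⟨s.comp, nearest init s.comp, nearest init s.comp⟩
      K (M + moves s.cur (nearest init s.comp)) S (R + 1) := by
  obtain ⟨hbal, hconst, hmin⟩ := isNearest_nearest init hf h.comp_le
  have hnear := hmin f hf h.comp_le
  have hlt := lt_moves_of_not_isValid h.ref_balanced hs
  constructor
  · exact h.comp_le
  · exact hconst
  · exact hbal
  · exact hnear
  · intro x p hp
    rw [Finset.card_eq_zero.2]
    · omega
    · exact Finset.filter_eq_empty_iff.2 fun y hy h' =>
        hp (h'.symm.trans (hconst y x (mem_cluster.1 hy)))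
  · exact h.small_le
  · exact fun h' => absurd h' R.succ_ne_zero
  · exact fun h' => absurd h' R.succ_ne_zero
  · have h₁ := h.drift
    simp only [moves_self]
    push_cast
    linarith
  · intro _
    -- Only the first rebalancing needs an argument: there `ref = init`, and settledness compares
    -- the drift with `D`.
    by_cases hR : R = 0
    · have h₁ : (moves s.ref s.cur : ℝ) ≤ 4 * moves s.ref f := by
        exact_mod_cast moves_le_four_mul_moves h.cur_const h.comp_le h.settled
      rw [h.ref_eq hR] at h₁ hlt
      exact hlt.le.trans h₁
    · exact h.far hR
  · have h₁ := h.moves_le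
    have h₂ := h.ref_near
    have h₃ := moves_triangle s.cur s.ref (nearest init s.comp)
    have h₄ := moves_triangle s.ref init (nearest init s.comp)
    rw [moves_comm s.cur s.ref] at h₃
    rw [moves_comm s.ref init] at h₄
    simp only [moves_self, Nat.mul_add]
    omega
  · exact h.comm_le

theorem Bookkeeping.merge (h : Bookkeeping ε init f s K M S R) (hbal : IsPerfectlyBalanced f)
    (hε : 0 ≤ ε) {u v : V} (huv : s.comp u ≠ s.comp v) (hf : f u = f v)
    (hle : (cluster s.comp u).card ≤ (cluster s.comp v).card) :
    ∃ S' R', Bookkeeping ε init f (s.merge ε init u v) (K + commCost s.cur (u, v))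
      (M + moves s.cur (s.merge ε init u v).cur) S' R' ∧ IsValid ε (s.merge ε init u v).cur := by
  obtain ⟨S', h'⟩ := h.absorb huv hf hle
  unfold State.merge
  split_ifs with hv
  · exact ⟨S', R, h', hv⟩
  -- The overflowing assignment is only a stage of the accounting; the actual move goes directly to
  -- the rebalanced one and is no longer.
  · refine ⟨S', R + 1, (h'.rebalance hbal hv).mono ?_,
      (isNearest_nearest init hbal h'.comp_le).1.isValid hε⟩
    rw [add_assoc]
    exact Nat.add_le_add_left (moves_triangle _ _ _) _

theorem commCost_swap {V : Type*} {ℓ : ℕ} (a : Assignment V ℓ) (u v : V) :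
    commCost a (u, v) = commCost a (v, u) := by
  simp only [commCost, eq_comm]

theorem Bookkeeping.step (h : Bookkeeping ε init f s K M S R) (hs : IsValid ε s.cur)
    (hbal : IsPerfectlyBalanced f) (hε : 0 ≤ ε) {e : V × V} (hf : f e.1 = f e.2) :
    ∃ S' R', Bookkeeping ε init f (s.step ε init e) (K + commCost s.cur e)
      (M + moves s.cur (s.step ε init e).cur) S' R' ∧ IsValid ε (s.step ε init e).cur := by
  unfold State.step
  split_ifs with h₁ h₂
  · refine ⟨S, R, ?_, hs⟩
    rw [moves_self, show commCost s.cur e = 0 from if_pos (h.cur_const _ _ h₁)]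
    exact h
  · exact h.merge hbal hε h₁ hf h₂
  · have h₃ := h.merge hbal hε (Ne.symm h₁) hf.symm (le_of_not_ge h₂)
    rwa [commCost_swap] at h₃

theorem scheduleCost_append (α : ℝ) (init : Assignment V ℓ) (σ : List (V × V)) (e : V × V)
    (b : ℕ → Assignment V ℓ) :
    scheduleCost α init (σ ++ [e]) b = scheduleCost α init σ b +
      (commCost (b σ.length) e + α * moves (b σ.length) (b (σ.length + 1))) := by
  unfold scheduleCost
  have hlen : (σ ++ [e]).length = σ.length + 1 := by simp
  rw [Finset.sum_fin_eq_sum_range, Finset.sum_fin_eq_sum_range,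
    congrArg Finset.range hlen, Finset.sum_range_succ, dif_pos (hlen ▸ Nat.lt_succ_self _),
    ← add_assoc]
  refine congrArg₂ _ (congrArg₂ _ rfl (Finset.sum_congr rfl fun i hi => ?_)) (by simp)
  rw [Finset.mem_range] at hi
  rw [dif_pos hi, dif_pos (hlen ▸ hi.trans (Nat.lt_succ_self _))]
  simp [List.getElem_append_left hi]

theorem scheduleCost_congr (α : ℝ) (init : Assignment V ℓ) (σ : List (V × V))
    {b b' : ℕ → Assignment V ℓ} (h : ∀ t ≤ σ.length, b t = b' t) :
    scheduleCost α init σ b = scheduleCost α init σ b' := by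
  unfold scheduleCost
  rw [h 0 (Nat.zero_le _)]
  refine congrArg₂ _ rfl (Finset.sum_congr rfl fun i _ => ?_)
  rw [h i i.2.le, h (i + 1) i.2]

/-- The run does not depend on `f`, so this applies to the final assignment of every feasible
schedule. -/
theorem exists_bookkeeping (α : ℝ) (hinit : IsPerfectlyBalanced init) (hbal : IsPerfectlyBalanced f)
    (hε : 0 ≤ ε) (σ : List (V × V)) (hf : ∀ e ∈ σ, f e.1 = f e.2) :
    ∃ K M S R, Bookkeeping ε init f (State.run ε init σ) K M S R ∧
      IsValid ε (State.run ε init σ).cur ∧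
      scheduleCost α init σ ((smallToLarge V ℓ ε).schedule init σ) = K + α * M ∧
      ∀ e ∈ σ, (State.run ε init σ).comp e.1 = (State.run ε init σ).comp e.2 := by
  induction σ using List.reverseRecOn with
  | nil =>
    refine ⟨0, 0, 0, 0, bookkeeping_start hinit, hinit.isValid hε, ?_, by simp⟩
    simp [scheduleCost, OnlineAlgorithm.schedule, smallToLarge, State.run, moves_self]
  | append_singleton σ e ih =>
    obtain ⟨K, M, S, R, hB, hv, hc, hcomp⟩ := ih fun e he => hf e (by simp [he])
    obtain ⟨S', R', hB', hv'⟩ := hB.step hv hbal hε (hf e (by simp))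
    rw [State.run_append]
    refine ⟨_, _, S', R', hB', hv', ?_, ?_⟩
    · rw [scheduleCost_append, scheduleCost_congr α init σ
        (b' := (smallToLarge V ℓ ε).schedule init σ), hc]
      · have h₁ : (σ ++ [e]).take σ.length = σ := List.take_left
        have h₂ : (σ ++ [e]).take (σ.length + 1) = σ ++ [e] := List.take_of_length_le (by simp)
        simp only [OnlineAlgorithm.schedule, smallToLarge, h₁, h₂, State.run_append]
        push_cast
        ring
      · intro t ht
        simp only [OnlineAlgorithm.schedule, List.take_append_of_le_length ht]
    · intro e' he'
      rcases List.mem_append.1 he' with he' | he'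
      · exact State.step_comp_of_eq _ _ _ _ (hcomp e' he')
      · rw [List.mem_singleton.1 he']
        exact State.step_comp_request _ _ _ _

/-- The invariant bounds the cost in terms of the number of moves from `init` to `f`. -/
theorem Bookkeeping.cost_le (h : Bookkeeping ε init f s K M S R) (hε : 0 < ε) (hε' : ε < 1)
    (hℓ : 2 ≤ ℓ) {α : ℝ} (hα : 1 ≤ α) [Nonempty V] :
    K + α * M ≤ 18 * (ℓ * Real.logb 2 (Fintype.card V) * Real.logb 2 ℓ / ε) *
      (α * moves init f) := by
  set D : ℝ := (moves init f : ℝ)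
  set L : ℝ := Real.logb 2 (Fintype.card V)
  set X : ℝ := ℓ * L / ε with hX
  have hn : (1 : ℝ) ≤ Fintype.card V := by exact_mod_cast Fintype.card_pos (α := V)
  have hℓ' : (2 : ℝ) ≤ ℓ := by exact_mod_cast hℓ
  have hL : 0 ≤ L := Real.logb_nonneg one_lt_two hn
  have hD : 0 ≤ D := Nat.cast_nonneg _
  have hX0 : 0 ≤ X := by positivity
  have hlog : 1 ≤ Real.logb 2 ℓ := by
    rw [Real.le_logb_iff_rpow_le one_lt_two (by positivity), Real.rpow_one]
    exact hℓ'
  have hKS : (K : ℝ) ≤ S := by exact_mod_cast h.comm_le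
  have hM : (M : ℝ) ≤ 3 * S + 2 * D * R := by
    have h' : ((M + 2 * moves s.ref s.cur : ℕ) : ℝ) ≤ (3 * S + 2 * moves init f * R : ℕ) :=
      Nat.cast_le.2 h.moves_le
    push_cast at h'
    have h'' : (0 : ℝ) ≤ moves s.ref s.cur := Nat.cast_nonneg _
    linarith
  -- In both cases `S ≤ 4 * X * D` and `R ≤ X`, so the constant is `4 * 4 + 2`.
  have key : 4 * (S : ℝ) + 2 * D * R ≤ 18 * X * D := by
    by_cases hR : R = 0
    · have h₁ := (h.small_le_of_eq hR).trans
        (mul_le_mul_of_nonneg_left (potential_le _ _) (by norm_num))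
      change (S : ℝ) ≤ 4 * (D * L) at h₁
      have h₂ : L ≤ X := by
        rw [hX, le_div_iff₀ hε, mul_comm]
        exact mul_le_mul_of_nonneg_right (by linarith) hL
      have h₃ := mul_le_mul_of_nonneg_left h₂ hD
      have h₄ := mul_nonneg hX0 hD
      subst hR
      push_cast
      nlinarith
    · have h₁ := h.small_le.trans (potential_le _ _)
      rw [Finset.card_univ] at h₁
      have h₂ := h.far hR
      have h₃ : (R : ℝ) * (ε * ((Fintype.card V : ℝ) / ℓ)) ≤ S := by
        have h₄ := h.drift
        have h₅ : (0 : ℝ) ≤ moves s.ref s.cur := Nat.cast_nonneg _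
        linarith
      have hY : 0 < ε * ((Fintype.card V : ℝ) / ℓ) := by positivity
      -- `X` is the potential bound `n log n` measured in units of the overflow threshold.
      have e : (Fintype.card V : ℝ) * L = X * (ε * ((Fintype.card V : ℝ) / ℓ)) := by
        rw [hX]
        field_simp
      have h₆ : (R : ℝ) ≤ X := by
        refine le_of_mul_le_mul_right ?_ hY
        rw [← e]
        exact h₃.trans h₁
      have h₇ : (S : ℝ) ≤ X * (4 * D) :=
        (h₁.trans_eq e).trans (mul_le_mul_of_nonneg_left h₂ hX0)
      have h₈ := mul_le_mul_of_nonneg_left h₆ hD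
      linarith
  have hα0 : 0 ≤ α := by linarith
  calc (K : ℝ) + α * M ≤ α * S + α * (3 * S + 2 * D * R) := by
        have h₁ : (K : ℝ) ≤ α * S := hKS.trans (le_mul_of_one_le_left (Nat.cast_nonneg _) hα)
        have h₂ := mul_le_mul_of_nonneg_left hM hα0
        linarith
    _ = α * (4 * S + 2 * D * R) := by ring
    _ ≤ α * (18 * X * D) := mul_le_mul_of_nonneg_left key hα0
    _ = 18 * X * (α * D) * 1 := by ring
    -- The bound already holds without the factor `log ℓ`, which is at least 1 here.
    _ ≤ 18 * X * (α * D) * Real.logb 2 ℓ := mul_le_mul_of_nonneg_left hlog (by positivity)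
    _ = _ := by rw [hX]; ring

end Algorithm

/-! ### Perfect partitionings and the offline lower bound. -/

section Partitionings

variable {V : Type*} {ℓ : ℕ}

theorem isPerfectPartitioning_of_bijective (G : SimpleGraph V) {g : G.ConnectedComponent → Fin ℓ}
    (hg : Function.Bijective g) :
    IsPerfectPartitioning G fun v => g (G.connectedComponentMk v) := by
  have h : ∀ c, {v | g (G.connectedComponentMk v) = g c} = c.supp := by
    intro c
    ext v
    simp [hg.1.eq_iff, SimpleGraph.ConnectedComponent.mem_supp_iff]
  unfold IsPerfectPartitioning
  ext X
  constructor
  · rintro ⟨j, rfl⟩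
    obtain ⟨c, rfl⟩ := hg.2 j
    exact ⟨c, (h c).symm⟩
  · rintro ⟨c, rfl⟩
    exact ⟨g c, h c⟩

theorem IsPerfectPartitioning.eq_iff {G : SimpleGraph V} {f : Assignment V ℓ}
    (hf : IsPerfectPartitioning G f) (x y : V) : f x = f y ↔ G.Reachable x y := by
  obtain ⟨c, hc⟩ : {v | f v = f y} ∈ Set.range fun c : G.ConnectedComponent => c.supp :=
    hf ▸ Set.mem_range_self (f y)
  have hc' : ∀ v, G.connectedComponentMk v = c ↔ f v = f y := fun v => Set.ext_iff.1 hc v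
  rw [← hc', ← (hc' y).2 rfl, SimpleGraph.ConnectedComponent.eq]

variable [Fintype V]

theorem IsPerfectPartitioning.isPerfectlyBalanced {G : SimpleGraph V} {f : Assignment V ℓ}
    (hf : IsPerfectPartitioning G f)
    (hG : ∀ c : G.ConnectedComponent, ℓ * c.supp.ncard = Fintype.card V) :
    IsPerfectlyBalanced f := by
  intro j
  obtain ⟨c, hc⟩ : {v | f v = j} ∈ Set.range fun c : G.ConnectedComponent => c.supp :=
    hf ▸ Set.mem_range_self j
  rw [← hG c, show c.supp = {v | f v = j} from hc, load, Set.ncard_eq_toFinset_card']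
  simp

theorem card_connectedComponent [Nonempty V] {G : SimpleGraph V}
    (hG : ∀ c : G.ConnectedComponent, ℓ * c.supp.ncard = Fintype.card V) :
    Nat.card G.ConnectedComponent = ℓ := by
  classical
  have hn : 0 < Fintype.card V := Fintype.card_pos
  have h : ∑ c : G.ConnectedComponent, c.supp.ncard = Fintype.card V := by
    rw [← Finset.card_univ, Finset.card_eq_sum_card_fiberwise (f := G.connectedComponentMk)
      (t := Finset.univ) (by simp)]
    refine Finset.sum_congr rfl fun c _ => ?_
    rw [Set.ncard_eq_toFinset_card']
    congr 1
    ext v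
    simp
  have h' : ℓ * Fintype.card V = Nat.card G.ConnectedComponent * Fintype.card V := by
    conv_lhs => rw [← h]
    rw [Finset.mul_sum, Finset.sum_congr rfl fun c _ => hG c, Finset.sum_const, Finset.card_univ,
      smul_eq_mul, Nat.card_eq_fintype_card]
  exact (Nat.eq_of_mul_eq_mul_right hn h').symm

theorem exists_isPerfectPartitioning [Nonempty V] {G : SimpleGraph V}
    (hG : ∀ c : G.ConnectedComponent, ℓ * c.supp.ncard = Fintype.card V) :
    ∃ f : Assignment V ℓ, IsPerfectPartitioning G f := by
  classical
  exact ⟨_, isPerfectPartitioning_of_bijective G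
    (Finite.equivFinOfCardEq (card_connectedComponent hG)).bijective⟩

/-- An assignment that separates no component and respects the capacities is a perfect
partitioning. -/
theorem isPerfectPartitioning_of_isValid [Nonempty V] {G : SimpleGraph V} {ε : ℝ} (hε : ε < 1)
    (hG : ∀ c : G.ConnectedComponent, ℓ * c.supp.ncard = Fintype.card V) {a : Assignment V ℓ}
    (ha : IsValid ε a) (hconst : ∀ x y, G.Reachable x y → a x = a y) :
    IsPerfectPartitioning G a := by
  classical
  have hn : (0 : ℝ) < Fintype.card V := by exact_mod_cast Fintype.card_pos (α := V)
  let g : G.ConnectedComponent → Fin ℓ :=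
    SimpleGraph.ConnectedComponent.lift a fun v w p _ => hconst v w p.reachable
  have hga : (fun v => g (G.connectedComponentMk v)) = a := rfl
  -- Two components on one server would give it load `2 n / ℓ`, above the capacity since `ε < 1`.
  have hinj : Function.Injective g := by
    intro c d hcd
    by_contra hne
    have hsub : c.supp ∪ d.supp ⊆ {v | a v = g c} := by
      rintro v (hv | hv)
      · rw [SimpleGraph.ConnectedComponent.mem_supp_iff] at hv
        exact congrArg g hv
      · rw [SimpleGraph.ConnectedComponent.mem_supp_iff] at hv
        exact (congrArg g hv).trans hcd.symm
    have hdis : Disjoint c.supp d.supp := by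
      rw [Set.disjoint_left]
      intro v hv hv'
      rw [SimpleGraph.ConnectedComponent.mem_supp_iff] at hv hv'
      exact hne (hv.symm.trans hv')
    have h₁ := Set.ncard_le_ncard hsub (Set.toFinite _)
    rw [Set.ncard_union_eq hdis (Set.toFinite _) (Set.toFinite _)] at h₁
    have h₂ : {v | a v = g c}.ncard = load a (g c) := by
      rw [load, Set.ncard_eq_toFinset_card']
      simp
    rw [h₂] at h₁
    have hℓ : (0 : ℝ) < ℓ := by exact_mod_cast (g c).pos
    have h₃ := ha (g c)
    rw [le_div_iff₀ hℓ] at h₃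
    have h₄ : (ℓ : ℝ) * c.supp.ncard = Fintype.card V := by exact_mod_cast hG c
    have h₅ : (ℓ : ℝ) * d.supp.ncard = Fintype.card V := by exact_mod_cast hG d
    have h₆ : (c.supp.ncard + d.supp.ncard : ℝ) ≤ load a (g c) := by exact_mod_cast h₁
    nlinarith
  have hbij : Function.Bijective g := by
    have := Fintype.ofFinite G.ConnectedComponent
    refine (Fintype.bijective_iff_injective_and_card g).2 ⟨hinj, ?_⟩
    rw [Fintype.card_fin, ← card_connectedComponent hG, Nat.card_eq_fintype_card]
  exact hga ▸ isPerfectPartitioning_of_bijective G hbij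

/-- The lower bound on the offline cost: drop the communication costs and apply the triangle
inequality. -/
theorem moves_le_scheduleCost (init : Assignment V ℓ) (σ : List (V × V)) {α : ℝ} (hα : 0 ≤ α)
    (b : ℕ → Assignment V ℓ) : α * moves init (b σ.length) ≤ scheduleCost α init σ b := by
  induction σ using List.reverseRecOn with
  | nil => simp [scheduleCost]
  | append_singleton σ e ih =>
    rw [scheduleCost_append, List.length_append, List.length_singleton]
    have h : (moves init (b (σ.length + 1)) : ℝ) ≤
        moves init (b σ.length) + moves (b σ.length) (b (σ.length + 1)) := by
      exact_mod_cast moves_triangle _ _ _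
    have h' := mul_le_mul_of_nonneg_left h hα
    have h'' : (0 : ℝ) ≤ commCost (b σ.length) e := Nat.cast_nonneg _
    linarith

end Partitionings

/-! ### Competitiveness. -/

theorem scheduleCost_eq_zero_of_subsingleton {V : Type*} [Fintype V] {ℓ : ℕ} [Subsingleton (Fin ℓ)]
    (α : ℝ) (init : Assignment V ℓ) (σ : List (V × V)) (b : ℕ → Assignment V ℓ) :
    scheduleCost α init σ b = 0 := by
  have h : ∀ a a' : Assignment V ℓ, moves a a' = 0 := fun a a' => by
    rw [Subsingleton.elim a a', moves_self]
  have h' : ∀ (a : Assignment V ℓ) (e : V × V), commCost a e = 0 := fun a e =>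
    if_pos (Subsingleton.elim _ _)
  simp [scheduleCost, h, h']

theorem smallToLarge_isCompetitive (V : Type*) [Fintype V] [Nonempty V] (ℓ : ℕ) {ε α : ℝ}
    (hε : 0 < ε) (hε' : ε < 1) (hα : 1 ≤ α) :
    (smallToLarge V ℓ ε).IsCompetitive α ε
      (18 * (ℓ * Real.logb 2 (Fintype.card V) * Real.logb 2 ℓ / ε)) := by
  intro G init σ hinit hσ
  have hreach : ∀ e ∈ σ, G.Reachable e.1 e.2 := fun e he => (hσ.adj_of_mem e he).reachable
  have hfeas : IsFeasible ε G σ ((smallToLarge V ℓ ε).schedule init σ) := by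
    obtain ⟨f, hf⟩ := exists_isPerfectPartitioning hσ.card_component
    have hbal := hf.isPerfectlyBalanced hσ.card_component
    have hfσ : ∀ e ∈ σ, f e.1 = f e.2 := fun e he => (hf.eq_iff _ _).2 (hreach e he)
    have hvalid : ∀ t, IsValid ε ((smallToLarge V ℓ ε).schedule init σ t) := fun t => by
      obtain ⟨_, _, _, _, _, h, _⟩ := exists_bookkeeping α hinit hbal hε.le (σ.take t)
        fun e he => hfσ e (List.mem_of_mem_take he)
      exact h
    refine ⟨fun t _ => hvalid t, isPerfectPartitioning_of_isValid hε' hσ.card_component (hvalid _) ?_⟩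
    obtain ⟨_, _, _, _, hB, _, _, hcomp⟩ := exists_bookkeeping α hinit hbal hε.le σ hfσ
    intro x y hxy
    rw [OnlineAlgorithm.schedule, List.take_length]
    refine hB.cur_const x y ?_
    obtain ⟨w⟩ := (hσ.reveals x y).2 hxy
    induction w with
    | nil => rfl
    | cons hadj w ih =>
      refine Eq.trans ?_ (ih ((hσ.reveals _ _).1 w.reachable))
      rcases hadj.2 with h | h
      · exact hcomp _ h
      · exact (hcomp _ h).symm
  refine ⟨hfeas, ?_⟩
  -- For `ℓ < 2` the factor `log ℓ` makes the ratio 0, so the cost itself must vanish, and it does.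
  rcases Nat.lt_or_ge ℓ 2 with hℓ | hℓ
  · have hsub : Subsingleton (Fin ℓ) := Fin.subsingleton_iff_le_one.2 (by omega)
    have hzero : Real.logb 2 (ℓ : ℝ) = 0 := by
      interval_cases ℓ <;> simp
    rw [scheduleCost_eq_zero_of_subsingleton, hzero]
    simp
  · set ρ := 18 * (ℓ * Real.logb 2 (Fintype.card V) * Real.logb 2 ℓ / ε) with hρ
    have hρ0 : 0 ≤ ρ := by
      have h₁ : 0 ≤ Real.logb 2 (Fintype.card V) :=
        Real.logb_nonneg one_lt_two (by exact_mod_cast Fintype.card_pos (α := V))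
      have h₂ : 0 ≤ Real.logb 2 (ℓ : ℝ) :=
        Real.logb_nonneg one_lt_two (by exact_mod_cast (by omega : 1 ≤ ℓ))
      positivity
    have hle : ∀ b, IsFeasible ε G σ b →
        scheduleCost α init σ ((smallToLarge V ℓ ε).schedule init σ) ≤
          ρ * scheduleCost α init σ b := by
      intro b hb
      obtain ⟨K, M, S, R, hB, _, hcost, _⟩ := exists_bookkeeping α hinit
        (hb.2.isPerfectlyBalanced hσ.card_component) hε.le σ
        fun e he => (hb.2.eq_iff _ _).2 (hreach e he)
      rw [hcost]
      exact (hB.cost_le hε hε' hℓ hα).trans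
        (mul_le_mul_of_nonneg_left (moves_le_scheduleCost init σ (by linarith) b) hρ0)
    unfold offlineCost
    rw [← smul_eq_mul, ← Real.sInf_smul_of_nonneg hρ0]
    -- The algorithm's own schedule shows that the infimum is over a nonempty set and is not the
    -- default value 0.
    refine le_csInf (Set.Nonempty.smul_set ⟨_, _, hfeas, rfl⟩) ?_
    rintro _ ⟨_, ⟨b, hb, rfl⟩, rfl⟩
    exact hle b hb

end OnlinePartition

theorem mainTheorem1 :
    ∃ C : ℝ, 0 < C ∧
      ∀ (V : Type*) [Fintype V] [Nonempty V] (ℓ : ℕ) (ε α : ℝ),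
        0 < ε → ε < 1 / 2 → 1 < α →
          ∃ A : OnlinePartition.OnlineAlgorithm V ℓ,
            A.IsCompetitive α ε
              (C * ((ℓ : ℝ) * Real.logb 2 (Fintype.card V : ℝ) * Real.logb 2 (ℓ : ℝ) / ε)) :=
  ⟨18, by norm_num, fun V _ _ ℓ _ _ hε hε' hα =>
    ⟨_, OnlinePartition.smallToLarge_isCompetitive V ℓ hε (by linarith) hα.le⟩⟩
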